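/- **Conventions.** Let $(\Omega,\mathcal A)$ be a measurable ("Borel") space and let $(X_\omega,d_\omega)_{\omega\in\Omega}$ be a family of metric spaces. A *Borel structure* on it is a set $\mathcal L(\Omega,X)\subseteq\prod_\omega X_\omega$ (the *Borel sections*) such that: (i) $\omega\mapsto d_\omega(x_\omega,y_\omega)$ is Borel for all $x,y\in\mathcal L(\Omega,X)$; (ii) every section $y$ for which $\omega\mapsto d_\omega(x_\omega,y_\omega)$ is Borel for all $x\in\mathcal L(\Omega,X)$ belongs to $\mathcal L(\Omega,X)$; (iii) there is a sequence $(x^n)$ in $\mathcal L(\Omega,X)$ with $\{x^n_\omega\}_n$ dense in $X_\omega$ for every $\omega$. The family together with $\mathcal L(\Omega,X)$ is a *Borel field of metric spaces*. $\mathcal L(\Omega,\mathcal C(X))$ is the set of families $f=(f_\omega)$ of continuous functions $f_\omega:X_\omega\to\mathbf R$ such that $\omega\mapsto f_\omega(x_\omega)$ is Borel for every $x\in\mathcal L(\Omega,X)$. Suppose that every $X_\omega$ is a proper CAT(0) space, and fix $x^0\in\mathcal L(\Omega,X)$. Let $\partial X_\omega$ be the set of classes of asymptotic geodesic rays with the conic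 topology. For $\xi\in\partial X_\omega$ let $c_{x,\xi}$ be the geodesic ray from $x$ to $\xi$, and let $b_{x_0,\xi}(x)=\lim_{t\to\infty}\big(d(x,c_{x_0,\xi}(t))-d(x_0,c_{x_0,\xi}(t))\big)$ be the Busemann function. For $\Omega'\subseteq\Omega$, a section $\xi=(\xi_\omega)_{\omega\in\Omega'}$ of $\partial X$ is Borel if $\omega\mapsto b_{x^0_\omega,\xi_\omega}(x_\omega)$ is Borel on $\Omega'$ for every $x\in\mathcal L(\Omega,X)$. A *Borel subfield* $B=(B_\omega)_{\omega\in\Omega}$, $B_\omega\subseteq\partial X_\omega$, is one for which $\Omega'=\{\omega: B_\omega\ne\emptyset\}$ is Borel and there are countably many Borel sections over $\Omega'$ with values in $B_\omega$ and dense in $B_\omega$ for every $\omega\in\Omega'$. A family $\pi=(\pi_\omega)_{\omega\in\Omega}$ of Borel probability measures $\pi_\omega$ on $B_\omega$ is a *Borel section of probabilities*, $\pi\in\mathcal L(\Omega,\mathrm{Prob}(B))$, if $\omega\mapsto\int f_\omega\,d\pi_\omega$ is Borel for every family of continuous functions $f_\omega:B_\omega\to\mathbf R$ such that $\omega\mapsto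 f_\omega(\xi_\omega)$ is Borel for every Borel section $\xi$ of $B$. A *Borel equivalence relation* is an equivalence relation $\mathcal R\subseteq\Omega^2$ that is a Borel set and has countable classes. An *action by isometries* $\alpha$ of $\mathcal R$ on the field is a family of bijective isometries $\alpha(\omega,\omega'):X_\omega\to X_{\omega'}$, $(\omega,\omega')\in\mathcal R$, with $\alpha(\omega',\omega'')\circ\alpha(\omega,\omega')=\alpha(\omega,\omega'')$, such that for every Borel automorphism $g$ of $\Omega$ with graph contained in $\mathcal R$ and every $x\in\mathcal L(\Omega,X)$ the section $\omega\mapsto\alpha(g^{-1}\omega,\omega)x_{g^{-1}\omega}$ is again in $\mathcal L(\Omega,X)$. It induces maps $\alpha(\omega,\omega'):\partial X_\omega\to\partial X_{\omega'}$; $B$ is *invariant* if $\alpha(\omega,\omega')B_\omega=B_{\omega'}$, and $\pi$ is *invariant* if $\alpha(\omega,\omega')_*\pi_\omega=\pi_{\omega'}$, for all $(\omega,\omega')\in\mathcal R$. **Proposition.** Let $(\Omega,\mathcal A)$ be a Borel space, $X$ a Borel field of proper CAT(0) spaces over $\Omega$, $x^0\in\mathcal L(\Omega,X)$, and $B$ a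 Borel subfield of $\partial X$ with every $B_\omega$ closed in $\partial X_\omega$. Let $\pi\in\mathcal L(\Omega,\mathrm{Prob}(B))$ and put $$b_\omega(x)=\int_{B_\omega}b_{x^0_\omega,\xi}(x)\,d\pi_\omega(\xi)\qquad(\omega\in\Omega,\ x\in X_\omega).$$ (i) These integrals are well defined (the integrands are integrable), $b=(b_\omega)_{\omega\in\Omega}$ belongs to $\mathcal L(\Omega,\mathcal C(X))$, and $b_\omega$ is convex for every $\omega\in\Omega$. (ii) If $\mathcal R\subseteq\Omega^2$ is a Borel equivalence relation and $\alpha$ is an action of $\mathcal R$ on $X$ by isometries such that $B$ and $\pi$ are invariant, then $b$ is quasi-invariant: for all $(\omega,\omega')\in\mathcal R$, $$b_\omega\circ\alpha(\omega',\omega)=b_{\omega'}+c(\omega,\omega'),\qquad c(\omega,\omega')=-\,b_{\omega'}\big(\alpha(\omega,\omega')x^0_\omega\big),$$ and $c$ is an additive cocycle: $c(\omega,\omega'')=c(\omega,\omega')+c(\omega',\omega'')$ whenever $(\omega,\omega'),(\omega',\omega'')\in\mathcal R$. -/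

import Mathlib

open Set Filter Topology MeasureTheory
open scoped NNReal

/-! ## CAT(0) spaces -/

/-- The map `c` is a geodesic on the set (interval) `I`: its restriction to `I` is isometric. -/
def IsGeodesicOn {X : Type*} [MetricSpace X] (c : ℝ → X) (I : Set ℝ) : Prop :=
  ∀ s ∈ I, ∀ t ∈ I, dist (c s) (c t) = |s - t|

/-- CAT(0) spaces: geodesic metric spaces such that, in every geodesic triangle, the distance from
a vertex `z` to a point `q = c t` of the opposite side is at most the corresponding distance in a
Euclidean comparison triangle. -/
structure IsCAT0 (X : Type*) [MetricSpace X] : Prop where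
  exists_geodesic : ∀ x y : X, ∃ c : ℝ → X,
    IsGeodesicOn c (Icc 0 (dist x y)) ∧ c 0 = x ∧ c (dist x y) = y
  comparison : ∀ (l : ℝ) (c : ℝ → X), 0 ≤ l → IsGeodesicOn c (Icc 0 l) →
    ∀ (z : X) (x' y' z' : EuclideanSpace ℝ (Fin 2)),
      dist x' y' = dist (c 0) (c l) → dist x' z' = dist (c 0) z → dist y' z' = dist (c l) z →
      ∀ t ∈ Icc (0 : ℝ) l, ∀ q' ∈ segment ℝ x' y', dist x' q' = dist (c 0) (c t) →
        dist z (c t) ≤ dist z' q'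

/-- A real function on a metric space is convex if it is convex along every geodesic segment. -/
def IsGeodesicallyConvex {X : Type*} [MetricSpace X] (f : X → ℝ) : Prop :=
  ∀ (a b : ℝ) (c : ℝ → X), IsGeodesicOn c (Icc a b) → ConvexOn ℝ (Icc a b) (fun t => f (c t))

/-! ## Boundary at infinity and Busemann functions -/

/-- Geodesic rays `[0, ∞) → X`. -/
structure GeodesicRay (X : Type*) [MetricSpace X] where
  toFun : ℝ≥0 → X
  isometry : Isometry toFun

/-- Two rays are asymptotic if they remain at bounded distance from each other. -/
def asymptoticSetoid (X : Type*) [MetricSpace X] : Setoid (GeodesicRay X) where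
  r c c' := ∃ K : ℝ, ∀ t, dist (c.toFun t) (c'.toFun t) ≤ K
  iseqv :=
    { refl := fun c => ⟨0, fun t => by simp⟩
      symm := fun ⟨K, hK⟩ => ⟨K, fun t => by rw [dist_comm]; exact hK t⟩
      trans := fun ⟨K, hK⟩ ⟨K', hK'⟩ =>
        ⟨K + K', fun t => (dist_triangle _ _ _).trans (add_le_add (hK t) (hK' t))⟩ }

/-- The boundary at infinity `∂X`: asymptoty classes of geodesic rays. -/
def Boundary (X : Type*) [MetricSpace X] : Type _ := Quotient (asymptoticSetoid X)

/-- The endpoint `c(∞)` of a ray. -/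
def GeodesicRay.endpoint {X : Type*} [MetricSpace X] (c : GeodesicRay X) : Boundary X :=
  Quotient.mk (asymptoticSetoid X) c

open Classical in
/-- The geodesic ray `c_{x,ξ}` with `c(0) = x` and `c(∞) = ξ`. In a proper CAT(0) space it exists
and is unique; the last branch is a default value for other spaces. -/
noncomputable def rayFrom {X : Type*} [MetricSpace X] (x : X) (ξ : Boundary X) : GeodesicRay X :=
  if h : ∃ c : GeodesicRay X, c.toFun 0 = x ∧ c.endpoint = ξ then h.choose else Quotient.out ξ

/-- The Busemann function
`b_{x₀,ξ}(x) = lim_{t → ∞} (d(x, c_{x₀,ξ}(t)) - d(x₀, c_{x₀,ξ}(t)))`. -/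
noncomputable def busemann {X : Type*} [MetricSpace X] (x₀ : X) (ξ : Boundary X) (x : X) : ℝ :=
  limUnder atTop fun t : ℝ≥0 =>
    dist x ((rayFrom x₀ ξ).toFun t) - dist x₀ ((rayFrom x₀ ξ).toFun t)

/-- The conic topology: `ξₙ → ξ` iff `c_{x,ξₙ}(t) → c_{x,ξ}(t)` for all `t ≥ 0`, for one or,
equivalently in a proper CAT(0) space, for every base point `x`. -/
noncomputable instance Boundary.instTopologicalSpace (X : Type*) [MetricSpace X] :
    TopologicalSpace (Boundary X) :=
  ⨅ x : X, TopologicalSpace.induced (fun ξ : Boundary X => (rayFrom x ξ).toFun) inferInstance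

noncomputable instance Boundary.instMeasurableSpace (X : Type*) [MetricSpace X] :
    MeasurableSpace (Boundary X) := borel _

instance Boundary.instBorelSpace (X : Type*) [MetricSpace X] : BorelSpace (Boundary X) := ⟨rfl⟩

/-- The map induced on boundaries by an isometric map. -/
def Boundary.map {X Y : Type*} [MetricSpace X] [MetricSpace Y] (γ : X → Y) (hγ : Isometry γ) :
    Boundary X → Boundary Y :=
  Quotient.map' (s₁ := asymptoticSetoid X) (s₂ := asymptoticSetoid Y)
    (fun c => ⟨γ ∘ c.toFun, hγ.comp c.isometry⟩)
    (fun _ _ ⟨K, hK⟩ => ⟨K, fun t => by simpa [hγ.dist_eq] using hK t⟩)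

/-! ## Borel fields of metric spaces -/

/-- A Borel structure `𝓛(Ω, X)` on a field of metric spaces. -/
structure BorelStructure {Ω : Type*} [MeasurableSpace Ω] (X : Ω → Type*)
    [∀ ω, MetricSpace (X ω)] where
  /-- the set of Borel sections -/
  sections : Set (∀ ω, X ω)
  compatibility : ∀ x ∈ sections, ∀ y ∈ sections, Measurable fun ω => dist (x ω) (y ω)
  maximality : ∀ y : ∀ ω, X ω,
    (∀ x ∈ sections, Measurable fun ω => dist (x ω) (y ω)) → y ∈ sections
  separability : ∃ D : ℕ → ∀ ω, X ω,
    (∀ n, D n ∈ sections) ∧ ∀ ω, closure (range fun n => D n ω) = univ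

section Fields

variable {Ω : Type*} [MeasurableSpace Ω] {X : Ω → Type*} [∀ ω, MetricSpace (X ω)]

/-- `f ∈ 𝓛(Ω, 𝓒(X))`: a section of continuous functions such that `f(x)` is Borel for every Borel
section `x`. -/
def IsBorelContinuousSection (S : BorelStructure X) (f : ∀ ω, X ω → ℝ) : Prop :=
  (∀ ω, Continuous (f ω)) ∧ ∀ x ∈ S.sections, Measurable fun ω => f ω (x ω)

/-- `ξ ∈ 𝓛(Ω', ∂X)` for a subset `Ω'` of the base. The Borel structure on `∂X` is the one inherited
from the field of continuous functions through `ξ ↦ b_{x⁰,ξ}`. -/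
def IsBorelBoundarySection (S : BorelStructure X) (x₀ : ∀ ω, X ω) (Ω' : Set Ω)
    (ξ : ∀ ω : Ω', Boundary (X ω)) : Prop :=
  ∀ x ∈ S.sections, Measurable fun ω : Ω' => busemann (x₀ ω) (ξ ω) (x ω)

/-- Borel subfields of `∂X`: the base `{ω | B_ω ≠ ∅}` is Borel and there are countably many Borel
sections of `B` over the base whose values are dense in `B_ω`. -/
def IsBorelBoundarySubfield (S : BorelStructure X) (x₀ : ∀ ω, X ω)
    (B : ∀ ω, Set (Boundary (X ω))) : Prop :=
  MeasurableSet {ω | (B ω).Nonempty} ∧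
    ∃ D : ℕ → ∀ ω : {ω | (B ω).Nonempty}, Boundary (X ω),
      (∀ n, IsBorelBoundarySection S x₀ _ (D n)) ∧
      (∀ n (ω : {ω | (B ω).Nonempty}), D n ω ∈ B ω) ∧
      ∀ ω : {ω | (B ω).Nonempty}, B ω ⊆ closure (range fun n => D n ω)

/-- `f ∈ 𝓛(Ω, 𝓒(B))`: `f(ξ)` is Borel for every Borel section `ξ` of `B`. -/
def IsBorelFunctionOnSubfield (S : BorelStructure X) (x₀ : ∀ ω, X ω)
    (B : ∀ ω, Set (Boundary (X ω))) (f : ∀ ω, C(B ω, ℝ)) : Prop :=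
  ∀ ξ : ∀ ω, B ω, IsBorelBoundarySection S x₀ univ (fun ω => (ξ ω : Boundary (X ω))) →
    Measurable fun ω => f ω (ξ ω)

/-- `π ∈ 𝓛(Ω, Prob(B))`: `ω ↦ ∫ f_ω dπ_ω` is Borel for every `f ∈ 𝓛(Ω, 𝓒(B))`. -/
def IsBorelProbSection (S : BorelStructure X) (x₀ : ∀ ω, X ω)
    (B : ∀ ω, Set (Boundary (X ω))) (π : ∀ ω, ProbabilityMeasure (B ω)) : Prop :=
  ∀ f : ∀ ω, C(B ω, ℝ), IsBorelFunctionOnSubfield S x₀ B f →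
    Measurable fun ω => ∫ ξ, f ω ξ ∂(π ω : Measure (B ω))

/-- The averaged Busemann function `b_ω(x) = ∫_{B_ω} b_{x⁰_ω,ξ}(x) dπ_ω(ξ)`. -/
noncomputable def averagedBusemann (x₀ : ∀ ω, X ω) (B : ∀ ω, Set (Boundary (X ω)))
    (π : ∀ ω, ProbabilityMeasure (B ω)) (ω : Ω) (x : X ω) : ℝ :=
  ∫ ξ : B ω, busemann (x₀ ω) (ξ : Boundary (X ω)) x ∂(π ω : Measure (B ω))

/-! ## Actions of Borel equivalence relations -/

/-- Borel equivalence relations: Borel, with countable classes. -/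
structure IsBorelEquivRel (R : Set (Ω × Ω)) : Prop where
  measurableSet : MeasurableSet R
  countable_class : ∀ ω, {ω' | (ω, ω') ∈ R}.Countable
  refl : ∀ ω, (ω, ω) ∈ R
  symm : ∀ ω ω', (ω, ω') ∈ R → (ω', ω) ∈ R
  trans : ∀ ω ω' ω'', (ω, ω') ∈ R → (ω', ω'') ∈ R → (ω, ω'') ∈ R

/-- An action of `R` on a Borel field: bijections `α(ω, ω') : X_ω → X_ω'` for `(ω, ω') ∈ R` with the
cocycle rule, such that the Borel sections are stable under
`(g x)_ω = α(g⁻¹ω, ω) x_{g⁻¹ω}` for every `g` in the full group of `R`. -/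
structure FieldAction (S : BorelStructure X) (R : Set (Ω × Ω)) where
  toFun : ∀ ω ω', (ω, ω') ∈ R → X ω → X ω'
  bijective : ∀ ω ω' (h : (ω, ω') ∈ R), Function.Bijective (toFun ω ω' h)
  cocycle : ∀ ω ω' ω'' (h : (ω, ω') ∈ R) (h' : (ω', ω'') ∈ R) (h'' : (ω, ω'') ∈ R) (x : X ω),
    toFun ω' ω'' h' (toFun ω ω' h x) = toFun ω ω'' h'' x
  smul_mem : ∀ (g : Ω ≃ᵐ Ω) (hg : ∀ ω, (ω, g ω) ∈ R), ∀ x ∈ S.sections,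
    (fun ω => toFun (g.symm ω) ω (by simpa using hg (g.symm ω)) (x (g.symm ω))) ∈ S.sections

variable {S : BorelStructure X} {R : Set (Ω × Ω)}

/-- The action is by isometries. -/
def FieldAction.IsIsometric (α : FieldAction S R) : Prop :=
  ∀ ω ω' (h : (ω, ω') ∈ R), Isometry (α.toFun ω ω' h)

/-- The induced maps `∂X_ω → ∂X_ω'`. -/
def FieldAction.boundaryMap (α : FieldAction S R) (hα : α.IsIsometric) (ω ω' : Ω)
    (h : (ω, ω') ∈ R) : Boundary (X ω) → Boundary (X ω') :=
  Boundary.map (α.toFun ω ω' h) (hα ω ω' h)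

/-- The subfield `B` of `∂X` is invariant: `α(ω, ω') B_ω = B_ω'`. -/
def FieldAction.IsInvariantSubfield (α : FieldAction S R) (hα : α.IsIsometric)
    (B : ∀ ω, Set (Boundary (X ω))) : Prop :=
  ∀ ω ω' (h : (ω, ω') ∈ R), α.boundaryMap hα ω ω' h '' B ω = B ω'

/-- The section `π` of probabilities is invariant: the image of `π_ω` under `α(ω, ω')` is `π_ω'`
(as measures on `∂X_ω'`). -/
def FieldAction.IsInvariantProb (α : FieldAction S R) (hα : α.IsIsometric)
    (B : ∀ ω, Set (Boundary (X ω))) (π : ∀ ω, ProbabilityMeasure (B ω)) : Prop :=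
  ∀ ω ω' (h : (ω, ω') ∈ R),
    Measure.map (fun ξ : B ω => α.boundaryMap hα ω ω' h ξ) (π ω : Measure (B ω)) =
      Measure.map (fun ξ : B ω' => (ξ : Boundary (X ω'))) (π ω' : Measure (B ω'))

/-- `f` is quasi-invariant with respect to `c : R → ℝ`:
`f_ω ∘ α(ω', ω) = f_ω' + c(ω, ω')` for every `(ω, ω') ∈ R`. -/
def FieldAction.IsQuasiInvariantWith (α : FieldAction S R) (f : ∀ ω, X ω → ℝ)
    (c : ∀ ω ω', (ω, ω') ∈ R → ℝ) : Prop :=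
  ∀ ω ω' (h : (ω, ω') ∈ R) (h' : (ω', ω) ∈ R) (y : X ω'),
    f ω (α.toFun ω' ω h' y) = f ω' y + c ω ω' h

/-- Additive cocycles on `R`: `c(ω, ω'') = c(ω, ω') + c(ω', ω'')`. -/
def IsAdditiveCocycle (R : Set (Ω × Ω)) (c : ∀ ω ω', (ω, ω') ∈ R → ℝ) : Prop :=
  ∀ ω ω' ω'' (h : (ω, ω') ∈ R) (h' : (ω', ω'') ∈ R) (h'' : (ω, ω'') ∈ R),
    c ω ω'' h'' = c ω ω' h + c ω' ω'' h'

end Fields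

/-! For fixed `x`, the map `ξ ↦ b_{x₀,ξ}(x)` is bounded by `d(x, x₀)` and continuous on the boundary
(`IsCAT0.continuous_busemann`). Hence it is integrable, and when `x` runs along a Borel section it
is an admissible test family, so the definition of a Borel section of probabilities gives
measurability of the averages. The 1-Lipschitz bound and convexity in `x` hold for each Busemann
function and survive integration.

Quasi-invariance is a change of variables. An isometry carries a Busemann function to a Busemann
function of the image point, up to a constant that depends on the base points
(`IsCAT0.busemann_map`). This rests on the fact that asymptotic rays have horofunctions differing by
a constant (`IsCAT0.horofunction_sub_eq`). Integrating against the invariant family of measures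
produces `c`, whose additivity is then formal.

All the geometry comes from Stewart's inequality `IsCAT0.dist_sq_le`: convexity of distances,
existence and uniqueness of rays with given origin and endpoint, a rate of convergence to
horofunctions that is uniform in the ray, and the four-point inequality behind
`IsCAT0.horofunction_sub_eq`. -/

/-! ## Metric inequalities in CAT(0) spaces -/

/-- In a CAT(0) space, Stewart's identity for Euclidean triangles becomes an inequality. -/
theorem IsCAT0.dist_sq_le {X : Type*} [MetricSpace X] (hX : IsCAT0 X) {c : ℝ → X} {l : ℝ}
    (hl : 0 ≤ l) (hc : IsGeodesicOn c (Icc 0 l)) (z : X) {s : ℝ} (hs : s ∈ Icc (0 : ℝ) 1) :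
    dist z (c (s * l)) ^ 2 ≤
      (1 - s) * dist z (c 0) ^ 2 + s * dist z (c l) ^ 2 - s * (1 - s) * l ^ 2 := by
  obtain ⟨hs0, hs1⟩ := hs
  rcases hl.eq_or_lt with rfl | hl
  · simp only [mul_zero]
    nlinarith
  have h0l : dist (c 0) (c l) = l := by
    rw [hc 0 ⟨le_rfl, hl.le⟩ l ⟨hl.le, le_rfl⟩, zero_sub, abs_neg, abs_of_pos hl]
  have hsl : s * l ∈ Icc 0 l := ⟨by positivity, by nlinarith⟩
  have h0s : dist (c 0) (c (s * l)) = s * l := by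
    rw [hc 0 ⟨le_rfl, hl.le⟩ _ hsl, zero_sub, abs_neg, abs_of_nonneg hsl.1]
  set A := dist z (c 0) with hA
  set B := dist z (c l) with hB
  have hA0 : 0 ≤ A := dist_nonneg
  have hB0 : 0 ≤ B := dist_nonneg
  have t1 : l ≤ A + B := by
    rw [← h0l, hA, dist_comm z (c 0)]; exact dist_triangle _ _ _
  have t2 : A ≤ B + l := by
    rw [← h0l, hA, hB, dist_comm (c 0)]; exact dist_triangle _ _ _
  have t3 : B ≤ A + l := by
    rw [← h0l, hA, hB]; exact dist_triangle _ _ _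
  -- The comparison triangle is `(0,0)`, `(l,0)`, `(u,v)`: the law of cosines dictates `u`, and the
  -- triangle inequalities make `A ^ 2 - u ^ 2` nonnegative, so that `v` exists.
  obtain ⟨u, hu⟩ : ∃ u : ℝ, 2 * l * u = A ^ 2 + l ^ 2 - B ^ 2 :=
    ⟨(A ^ 2 + l ^ 2 - B ^ 2) / (2 * l), by field_simp⟩
  have huA : u ^ 2 ≤ A ^ 2 := by
    apply sq_le_sq'
    · have : 0 ≤ 2 * l * (u + A) := by
        have : 2 * l * (u + A) = (A + l - B) * (A + l + B) := by rw [mul_add, hu]; ring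
        rw [this]; exact mul_nonneg (by linarith) (by linarith)
      have := nonneg_of_mul_nonneg_right this (by positivity)
      linarith
    · have : 0 ≤ 2 * l * (A - u) := by
        have : 2 * l * (A - u) = (B - A + l) * (B + A - l) := by rw [mul_sub, hu]; ring
        rw [this]; exact mul_nonneg (by linarith) (by linarith)
      have := nonneg_of_mul_nonneg_right this (by positivity)
      linarith
  have hv : Real.sqrt (A ^ 2 - u ^ 2) ^ 2 = A ^ 2 - u ^ 2 := Real.sq_sqrt (by linarith)
  set v := Real.sqrt (A ^ 2 - u ^ 2)
  have key := hX.comparison l c hl.le hc z !₂[0, 0] !₂[l, 0] !₂[u, v]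
    (by simp [EuclideanSpace.dist_eq, Fin.sum_univ_two, h0l, Real.sqrt_sq_eq_abs, abs_of_pos hl])
    (by
      rw [dist_comm (c 0), ← hA, EuclideanSpace.dist_eq, Real.sqrt_eq_iff_mul_self_eq (by positivity) hA0]
      simp [Fin.sum_univ_two, Real.dist_eq, hv]
      ring)
    (by
      rw [dist_comm (c l), ← hB, EuclideanSpace.dist_eq, Real.sqrt_eq_iff_mul_self_eq (by positivity) hB0]
      simp [Fin.sum_univ_two, Real.dist_eq, hv]
      linarith [hu])
    (s * l) hsl !₂[s * l, 0]
    ⟨1 - s, s, by linarith, hs0, by ring, by ext i; fin_cases i <;> simp⟩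
    (by simp [EuclideanSpace.dist_eq, Fin.sum_univ_two, h0s, Real.sqrt_sq_eq_abs,
          abs_of_pos hl, abs_of_nonneg hs0])
  have h2 : dist (!₂[u, v] : EuclideanSpace ℝ (Fin 2)) !₂[s * l, 0] ^ 2 =
      (u - s * l) ^ 2 + v ^ 2 := by
    rw [EuclideanSpace.dist_eq, Real.sq_sqrt (by positivity)]
    simp [Fin.sum_univ_two, Real.dist_eq]
  calc dist z (c (s * l)) ^ 2 ≤ _ := pow_le_pow_left₀ dist_nonneg key 2
    _ = _ := h2
    _ = (1 - s) * A ^ 2 + s * B ^ 2 - s * (1 - s) * l ^ 2 := by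
      rw [hv]; linear_combination (-s) * hu

/-- The distance to a point is convex along geodesic segments. -/
theorem IsCAT0.isGeodesicallyConvex_dist {X : Type*} [MetricSpace X] (hX : IsCAT0 X) (z : X) :
    IsGeodesicallyConvex (fun x => dist x z) := by
  intro a b c hc
  refine ⟨convex_Icc a b, ?_⟩
  have main : ∀ x ∈ Icc a b, ∀ y ∈ Icc a b, x ≤ y → ∀ s ∈ Icc (0 : ℝ) 1,
      dist (c (x + s * (y - x))) z ≤ (1 - s) * dist (c x) z + s * dist (c y) z := by
    intro x hx y hy hxy s hs
    have hg : IsGeodesicOn (fun r => c (x + r)) (Icc 0 (y - x)) := by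
      intro r hr r' hr'
      dsimp only
      rw [hc _ ⟨by linarith [hx.1, hr.1], by linarith [hy.2, hr.2]⟩ _
        ⟨by linarith [hx.1, hr'.1], by linarith [hy.2, hr'.2]⟩]
      congr 1; ring
    have h := hX.dist_sq_le (sub_nonneg.2 hxy) hg z hs
    have hd : |dist z (c x) - dist z (c y)| ≤ y - x := by
      have h1 := hc x hx y hy
      rw [abs_sub_comm, abs_of_nonneg (sub_nonneg.2 hxy)] at h1
      rw [← h1, dist_comm z, dist_comm z]
      exact abs_dist_sub_le _ _ _
    simp only [add_zero, add_sub_cancel] at h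
    rw [dist_comm _ z, dist_comm _ z, dist_comm _ z]
    have hd2 := sq_le_sq' (abs_le.1 hd).1 (abs_le.1 hd).2
    have hss : 0 ≤ s * (1 - s) := mul_nonneg hs.1 (sub_nonneg.2 hs.2)
    -- With `A`, `B` the distances from `z` to the two ends, `((1-s)A + sB)² = (1-s)A² + sB² -
    -- s(1-s)(A-B)²`, so Stewart's inequality suffices because `|A - B| ≤ y - x`.
    refine abs_le_of_sq_le_sq' ?_ ?_ |>.2
    · nlinarith [mul_le_mul_of_nonneg_left hd2 hss]
    · exact add_nonneg (mul_nonneg (sub_nonneg.2 hs.2) dist_nonneg) (mul_nonneg hs.1 dist_nonneg)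
  intro x hx y hy p q hp hq hpq
  simp only [smul_eq_mul]
  rcases le_total x y with hxy | hxy
  · have := main x hx y hy hxy q ⟨hq, by linarith⟩
    rw [show x + q * (y - x) = p * x + q * y by rw [← sub_eq_of_eq_add' hpq.symm]; ring,
      show 1 - q = p by linarith] at this
    exact this
  · have := main y hy x hx hxy p ⟨hp, by linarith⟩
    rw [show y + p * (x - y) = p * x + q * y by rw [← sub_eq_of_eq_add hpq.symm]; ring,
      show 1 - p = q by linarith] at this
    linarith

/-- Geodesic segments with a common starting point diverge at least linearly. -/
theorem IsCAT0.dist_le_mul_dist {X : Type*} [MetricSpace X] (hX : IsCAT0 X) {a b : ℝ → X}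
    {l m : ℝ} (hl : 0 ≤ l) (hm : 0 ≤ m) (ha : IsGeodesicOn a (Icc 0 l))
    (hb : IsGeodesicOn b (Icc 0 m)) (hab : a 0 = b 0) {s : ℝ} (hs : s ∈ Icc (0 : ℝ) 1) :
    dist (a (s * l)) (b (s * m)) ≤ s * dist (a l) (b m) := by
  -- Stewart is applied along `a` and then along `b`; when the second bound is inserted in the
  -- first, all terms in `l` and `m` cancel and `s² d(a l, b m)²` remains.
  have h1 := hX.dist_sq_le hl ha (b (s * m)) hs
  have h2 := hX.dist_sq_le hm hb (a l) hs
  have hsm : s * m ∈ Icc 0 m := ⟨mul_nonneg hs.1 hm, mul_le_of_le_one_left hm hs.2⟩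
  have h3 : dist (b (s * m)) (a 0) = s * m := by
    rw [hab, hb _ hsm 0 ⟨le_rfl, hm⟩, sub_zero, abs_of_nonneg hsm.1]
  have h4 : dist (a l) (b 0) = l := by
    rw [← hab, ha l ⟨hl, le_rfl⟩ 0 ⟨le_rfl, hl⟩, sub_zero, abs_of_nonneg hl]
  rw [h3, dist_comm _ (a l)] at h1
  rw [h4] at h2
  rw [dist_comm]
  refine abs_le_of_sq_le_sq' ?_ (mul_nonneg hs.1 dist_nonneg) |>.2
  nlinarith [mul_le_mul_of_nonneg_left h2 hs.1]

/-- The four-point inequality: the squares of the diagonals of a quadrilateral are bounded by the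
squares of its sides. -/
theorem IsCAT0.dist_sq_add_dist_sq_le {X : Type*} [MetricSpace X] (hX : IsCAT0 X) (x y p q : X) :
    dist x q ^ 2 + dist y p ^ 2 ≤
      dist x p ^ 2 + dist y q ^ 2 + dist x y ^ 2 + dist p q ^ 2 := by
  obtain ⟨g, hg, h0, h1⟩ := hX.exists_geodesic x q
  have hs : (1 / 2 : ℝ) ∈ Icc (0 : ℝ) 1 := by constructor <;> norm_num
  -- Both inequalities concern the midpoint `m` of `x` and `q`; they are added and combined with
  -- `d(y,p)² ≤ 2 (d(y,m)² + d(p,m)²)`.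
  have hp := hX.dist_sq_le dist_nonneg hg p hs
  have hy := hX.dist_sq_le dist_nonneg hg y hs
  rw [h0, h1] at hp hy
  set m := g (1 / 2 * dist x q)
  have ht : dist y p ≤ dist y m + dist p m := by
    rw [dist_comm p m]; exact dist_triangle _ _ _
  have ht2 := pow_le_pow_left₀ dist_nonneg ht 2
  rw [dist_comm p x] at hp
  rw [dist_comm y x] at hy
  nlinarith [sq_nonneg (dist y m - dist p m)]

/-! ## Geodesic rays -/

theorem GeodesicRay.dist_eq {X : Type*} [MetricSpace X] (c : GeodesicRay X) (s t : ℝ≥0) :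
    dist (c.toFun s) (c.toFun t) = |(s : ℝ) - t| := by
  rw [c.isometry.dist_eq, NNReal.dist_eq]

theorem GeodesicRay.isGeodesicOn {X : Type*} [MetricSpace X] (c : GeodesicRay X) (l : ℝ) :
    IsGeodesicOn (fun t : ℝ => c.toFun t.toNNReal) (Icc 0 l) := by
  intro s hs t ht
  rw [c.dist_eq, Real.coe_toNNReal _ hs.1, Real.coe_toNNReal _ ht.1]

theorem IsGeodesicOn.comp_sub {X : Type*} [MetricSpace X] {c : ℝ → X} {l : ℝ}
    (hc : IsGeodesicOn c (Icc 0 l)) : IsGeodesicOn (fun t => c (l - t)) (Icc 0 l) := by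
  intro s hs t ht
  dsimp only
  rw [hc _ ⟨by linarith [hs.2], by linarith [hs.1]⟩ _ ⟨by linarith [ht.2], by linarith [ht.1]⟩,
    abs_sub_comm]
  congr 1; ring

/-- A segment from `x` to a point of a ray `c` stays close to `c`. -/
theorem IsCAT0.dist_segment_ray_le {X : Type*} [MetricSpace X] (hX : IsCAT0 X)
    (c : GeodesicRay X) {g : ℝ → X} {l : ℝ} {n t : ℝ≥0} (hl : 0 < l)
    (hg : IsGeodesicOn g (Icc 0 l)) (hgl : g l = c.toFun n) (htl : t ≤ l) :
    dist (g t) (c.toFun t) ≤ 2 * dist (g 0) (c.toFun 0) := by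
  -- Both geodesics are reversed so that they start at the common point `c n`. At this ratio they
  -- reach `g t` and `c (t n / l)`; the latter lies within `|n - l|` of `c t`.
  have hs : (l - t) / l ∈ Icc (0 : ℝ) 1 :=
    ⟨div_nonneg (by linarith) hl.le, (div_le_one hl).2 (by linarith [t.coe_nonneg])⟩
  have h := hX.dist_le_mul_dist hl.le n.coe_nonneg hg.comp_sub (c.isGeodesicOn n).comp_sub
    (by simp [hgl]) hs
  have e1 : l - (l - t) / l * l = t := by field_simp; ring
  have e2 : (n : ℝ) - (l - t) / l * n = t / l * n := by field_simp; ring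
  simp only [e1, e2, sub_self, Real.toNNReal_zero] at h
  have hln : |(n : ℝ) - l| ≤ dist (g 0) (c.toFun 0) := by
    have h1 := c.dist_eq n 0
    have h2 := hg l ⟨hl.le, le_rfl⟩ 0 ⟨le_rfl, hl.le⟩
    rw [NNReal.coe_zero, sub_zero, abs_of_nonneg n.coe_nonneg] at h1
    rw [sub_zero, abs_of_pos hl, hgl] at h2
    rw [← h1, ← h2, dist_comm (g 0), dist_comm (c.toFun n), dist_comm (c.toFun n)]
    exact abs_dist_sub_le _ _ _
  have hd : dist (c.toFun (t / l * n).toNNReal) (c.toFun t) ≤ dist (g 0) (c.toFun 0) := by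
    rw [c.dist_eq, Real.coe_toNNReal _ (by positivity),
      show (t : ℝ) / l * n - t = t / l * (n - l) by field_simp, abs_mul,
      abs_of_nonneg (by positivity)]
    refine le_trans (mul_le_of_le_one_left (abs_nonneg _) ((div_le_one hl).2 htl)) hln
  have := mul_le_of_le_one_left (dist_nonneg (x := g 0) (y := c.toFun 0)) hs.2
  linarith [dist_triangle (g t) (c.toFun (t / l * n).toNNReal) (c.toFun t)]

/-- In a proper CAT(0) space, every point of the boundary is the endpoint of a ray issued from a
given point. -/
theorem IsCAT0.exists_ray {X : Type*} [MetricSpace X] [ProperSpace X] (hX : IsCAT0 X) (x : X)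
    (ξ : Boundary X) : ∃ c : GeodesicRay X, c.toFun 0 = x ∧ c.endpoint = ξ := by
  induction ξ using Quotient.inductionOn with
  | h c =>
  choose g hg hg0 hgl using fun n : ℕ => hX.exists_geodesic x (c.toFun n)
  set l : ℕ → ℝ := fun n => dist x (c.toFun n)
  have hl0 : ∀ n, 0 ≤ l n := fun n => dist_nonneg
  have hl : Tendsto l atTop atTop := by
    refine tendsto_atTop_mono (f := fun n : ℕ => (n : ℝ) - dist x (c.toFun 0)) (fun n => ?_)
      (tendsto_atTop_add_const_right _ _ tendsto_natCast_atTop_atTop)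
    have h1 := c.dist_eq 0 n
    simp only [NNReal.coe_zero, NNReal.coe_natCast, zero_sub, abs_neg, Nat.abs_cast] at h1
    have := dist_triangle_left (c.toFun 0) (c.toFun n) x
    simp only [l]; linarith
  -- The segments are frozen after their endpoints, which places them all in a product of closed
  -- balls, compact by Tychonoff. A limit along an ultrafilter replaces the extraction of a
  -- subsequence.
  set G : ℕ → ℝ≥0 → X := fun n t => g n (min t (l n))
  have hGmem : ∀ n, G n ∈ univ.pi fun t : ℝ≥0 => Metric.closedBall x t := by
    intro n t _
    rw [Metric.mem_closedBall, dist_comm]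
    conv_lhs => rw [← hg0 n]
    rw [hg n 0 ⟨le_rfl, hl0 n⟩ _ ⟨le_min t.coe_nonneg (hl0 n), min_le_right _ _⟩, zero_sub, abs_neg,
      abs_of_nonneg (le_min t.coe_nonneg (hl0 n))]
    exact min_le_left _ _
  have hcpt : IsCompact (univ.pi fun t : ℝ≥0 => Metric.closedBall x (t : ℝ)) :=
    isCompact_univ_pi fun t => isCompact_closedBall _ _
  obtain ⟨γ, -, hγ⟩ := hcpt.ultrafilter_le_nhds ((Ultrafilter.of atTop).map G)
    (by
      rw [le_principal_iff]
      exact Ultrafilter.mem_map.2 (Filter.mem_of_superset univ_mem fun n _ => hGmem n))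
  have hlim : ∀ t, Tendsto (fun n => G n t) (Ultrafilter.of atTop : Ultrafilter ℕ) (𝓝 (γ t)) :=
    tendsto_pi_nhds.1 hγ
  have hev : ∀ t : ℝ≥0, ∀ᶠ n in (Ultrafilter.of atTop : Ultrafilter ℕ), 0 < l n ∧ (t : ℝ) ≤ l n :=
    fun t => Ultrafilter.of_le atTop ((hl.eventually_gt_atTop 0).and (hl.eventually_ge_atTop t))
  have hiso : Isometry γ := by
    refine Isometry.of_dist_eq fun s t => ?_
    refine tendsto_nhds_unique ((hlim s).dist (hlim t)) (tendsto_const_nhds.congr' ?_)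
    filter_upwards [hev s, hev t] with n hs ht
    simp only [G]
    rw [min_eq_left hs.2, min_eq_left ht.2, hg n _ ⟨s.coe_nonneg, hs.2⟩ _ ⟨t.coe_nonneg, ht.2⟩,
      NNReal.dist_eq]
  refine ⟨⟨γ, hiso⟩, ?_, Quotient.sound ⟨2 * dist x (c.toFun 0), fun t => ?_⟩⟩
  · refine tendsto_nhds_unique (hlim 0) (tendsto_const_nhds.congr fun n => ?_)
    simp only [G, NNReal.coe_zero, min_eq_left (hl0 n), hg0]
  · refine le_of_tendsto ((hlim t).dist tendsto_const_nhds) ?_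
    filter_upwards [hev t] with n hn
    have := hX.dist_segment_ray_le c (n := n) hn.1 (hg n) (hgl n) hn.2
    simp only [G]
    rwa [min_eq_left hn.2, ← hg0 n, hg0 n, ← hg0 n]

/-- Asymptotic rays with the same origin coincide. -/
theorem IsCAT0.ray_unique {X : Type*} [MetricSpace X] (hX : IsCAT0 X) {c c' : GeodesicRay X}
    (h0 : c.toFun 0 = c'.toFun 0) (h : c.endpoint = c'.endpoint) : c = c' := by
  obtain ⟨K, hK⟩ : ∃ K : ℝ, ∀ t, dist (c.toFun t) (c'.toFun t) ≤ K := Quotient.exact h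
  suffices c.toFun = c'.toFun by cases c; cases c'; simpa using this
  funext t
  -- Linear divergence from the common origin gives `d(c t, c' t) ≤ (t / T) K` for every large `T`.
  refine dist_le_zero.1 (ge_of_tendsto
    ((tendsto_const_nhds (x := (t : ℝ) * K)).div_atTop tendsto_id) ?_)
  filter_upwards [eventually_ge_atTop (t : ℝ), eventually_gt_atTop 0] with T hT hT0
  have hs : (t : ℝ) / T ∈ Icc (0 : ℝ) 1 := ⟨by positivity, (div_le_one hT0).2 hT⟩
  have := hX.dist_le_mul_dist hT0.le hT0.le (c.isGeodesicOn T) (c'.isGeodesicOn T) (by simpa) hs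
  rw [div_mul_cancel₀ _ hT0.ne', Real.toNNReal_coe] at this
  refine this.trans ?_
  rw [id, mul_div_right_comm]
  exact mul_le_mul_of_nonneg_left (hK _) hs.1

theorem endpoint_rayFrom {X : Type*} [MetricSpace X] (x : X) (ξ : Boundary X) :
    (rayFrom x ξ).endpoint = ξ := by
  unfold rayFrom
  split_ifs with h
  · exact h.choose_spec.2
  · exact Quotient.out_eq ξ

theorem IsCAT0.rayFrom_zero {X : Type*} [MetricSpace X] [ProperSpace X] (hX : IsCAT0 X) (x : X)
    (ξ : Boundary X) : (rayFrom x ξ).toFun 0 = x := by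
  have h := hX.exists_ray x ξ
  rw [rayFrom, dif_pos h]
  exact h.choose_spec.1

/-- The image of a geodesic ray under an isometric map. -/
def GeodesicRay.map {X Y : Type*} [MetricSpace X] [MetricSpace Y] (γ : X → Y) (hγ : Isometry γ)
    (c : GeodesicRay X) : GeodesicRay Y :=
  ⟨γ ∘ c.toFun, hγ.comp c.isometry⟩

theorem GeodesicRay.endpoint_map {X Y : Type*} [MetricSpace X] [MetricSpace Y] (γ : X → Y)
    (hγ : Isometry γ) (c : GeodesicRay X) :
    (c.map γ hγ).endpoint = Boundary.map γ hγ c.endpoint := rfl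

theorem IsCAT0.rayFrom_map {X Y : Type*} [MetricSpace X] [MetricSpace Y] [ProperSpace X]
    [ProperSpace Y] (hX : IsCAT0 X) (hY : IsCAT0 Y) {γ : X → Y} (hγ : Isometry γ) (x : X)
    (ξ : Boundary X) : rayFrom (γ x) (Boundary.map γ hγ ξ) = (rayFrom x ξ).map γ hγ := by
  apply hY.ray_unique
  · rw [hY.rayFrom_zero]
    exact congrArg γ (hX.rayFrom_zero x ξ).symm
  · rw [endpoint_rayFrom, GeodesicRay.endpoint_map, endpoint_rayFrom]

theorem continuous_rayFrom_apply {X : Type*} [MetricSpace X] (x : X) (t : ℝ≥0) :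
    Continuous fun ξ : Boundary X => (rayFrom x ξ).toFun t :=
  (continuous_apply t).comp
    (continuous_iInf_dom (i := x) (continuous_induced_dom (f := fun ξ => (rayFrom x ξ).toFun)))

/-- A surjective isometry of proper CAT(0) spaces induces a continuous map on the boundaries. -/
theorem IsCAT0.continuous_boundaryMap {X Y : Type*} [MetricSpace X] [MetricSpace Y]
    [ProperSpace X] [ProperSpace Y] (hX : IsCAT0 X) (hY : IsCAT0 Y) {γ : X → Y} (hγ : Isometry γ)
    (hs : Function.Surjective γ) : Continuous (Boundary.map γ hγ) := by
  refine continuous_iInf_rng.2 fun y => continuous_induced_rng.2 (continuous_pi fun t => ?_)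
  -- The topology involves every base point `y` of the target; surjectivity turns each into an image
  -- `γ x`, where rays are images of rays from `x`.
  obtain ⟨x, rfl⟩ := hs y
  simp only [Function.comp_apply, hX.rayFrom_map hY hγ]
  exact hγ.continuous.comp (continuous_rayFrom_apply x t)

/-! ## Horofunctions -/

/-- The horofunction `x ↦ lim_{t → ∞} (d(x, c(t)) - t)` of a geodesic ray. -/
noncomputable def GeodesicRay.horofunction {X : Type*} [MetricSpace X] (c : GeodesicRay X)
    (x : X) : ℝ :=
  ⨅ t : ℝ≥0, (dist x (c.toFun t) - t)

section Horofunction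

variable {X : Type*} [MetricSpace X] (c : GeodesicRay X)

theorem GeodesicRay.antitone_dist_sub (x : X) :
    Antitone fun t : ℝ≥0 => dist x (c.toFun t) - (t : ℝ) := by
  intro s t hst
  have h := c.dist_eq s t
  rw [abs_sub_comm, abs_of_nonneg (sub_nonneg.2 (NNReal.coe_le_coe.2 hst))] at h
  have := dist_triangle x (c.toFun s) (c.toFun t)
  dsimp only
  linarith

theorem GeodesicRay.neg_dist_le_dist_sub (x : X) (t : ℝ≥0) :
    -dist x (c.toFun 0) ≤ dist x (c.toFun t) - t := by
  have h := c.dist_eq 0 t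
  rw [NNReal.coe_zero, zero_sub, abs_neg, abs_of_nonneg t.coe_nonneg] at h
  have := dist_triangle_left (c.toFun 0) (c.toFun t) x
  linarith

theorem GeodesicRay.bddBelow_dist_sub (x : X) :
    BddBelow (range fun t : ℝ≥0 => dist x (c.toFun t) - (t : ℝ)) :=
  ⟨_, forall_mem_range.2 (c.neg_dist_le_dist_sub x)⟩

theorem GeodesicRay.tendsto_horofunction (x : X) :
    Tendsto (fun t : ℝ≥0 => dist x (c.toFun t) - (t : ℝ)) atTop (𝓝 (c.horofunction x)) :=
  tendsto_atTop_ciInf (c.antitone_dist_sub x) (c.bddBelow_dist_sub x)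

theorem GeodesicRay.horofunction_le (x : X) (t : ℝ≥0) :
    c.horofunction x ≤ dist x (c.toFun t) - t :=
  ciInf_le (c.bddBelow_dist_sub x) t

theorem GeodesicRay.horofunction_zero : c.horofunction (c.toFun 0) = 0 := by
  refine tendsto_nhds_unique (c.tendsto_horofunction _) (tendsto_const_nhds.congr fun t => ?_)
  rw [c.dist_eq, NNReal.coe_zero, zero_sub, abs_neg, abs_of_nonneg t.coe_nonneg, sub_self]

theorem GeodesicRay.abs_horofunction_sub_le (x y : X) :
    |c.horofunction x - c.horofunction y| ≤ dist x y := by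
  refine le_of_tendsto ((c.tendsto_horofunction x).sub (c.tendsto_horofunction y)).abs
    (Eventually.of_forall fun t => ?_)
  rw [sub_sub_sub_cancel_right]
  exact abs_dist_sub_le _ _ _

theorem GeodesicRay.horofunction_map {Y : Type*} [MetricSpace Y] {γ : X → Y} (hγ : Isometry γ)
    (x : X) : (c.map γ hγ).horofunction (γ x) = c.horofunction x := by
  simp [GeodesicRay.horofunction, GeodesicRay.map, hγ.dist_eq]

theorem IsCAT0.isGeodesicallyConvex_horofunction (hX : IsCAT0 X) :
    IsGeodesicallyConvex c.horofunction := by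
  intro a b g hg
  refine ⟨convex_Icc a b, fun x hx y hy p q hp hq hpq => ?_⟩
  simp only [smul_eq_mul]
  refine le_of_tendsto_of_tendsto' (c.tendsto_horofunction _)
    (((c.tendsto_horofunction _).const_mul p).add ((c.tendsto_horofunction _).const_mul q))
    fun t => ?_
  have h := (hX.isGeodesicallyConvex_dist (c.toFun t) a b g hg).2 hx hy hp hq hpq
  simp only [smul_eq_mul] at h
  linear_combination h + (t : ℝ) * hpq

/-- The convergence to the horofunction is uniform over the rays issued from a given point. -/
theorem IsCAT0.dist_sub_le_horofunction_add (hX : IsCAT0 X) (x : X) {t : ℝ≥0}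
    (ht : dist x (c.toFun 0) < t) :
    dist x (c.toFun t) - t ≤
      c.horofunction x + dist x (c.toFun 0) ^ 2 / (2 * (t - dist x (c.toFun 0))) := by
  refine ge_of_tendsto ((c.tendsto_horofunction x).add_const _) ?_
  filter_upwards [eventually_ge_atTop t] with s hts
  set d := dist x (c.toFun 0)
  have hd0 : 0 ≤ d := dist_nonneg
  have hts' : (t : ℝ) ≤ s := hts
  have ht0 : (0 : ℝ) < t := hd0.trans_lt ht
  have hs0 : (0 : ℝ) < s := ht0.trans_le hts'
  have hr : (t : ℝ) / s ∈ Icc (0 : ℝ) 1 := ⟨by positivity, (div_le_one hs0).2 hts'⟩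
  have h := hX.dist_sq_le hs0.le (c.isGeodesicOn s) x hr
  rw [div_mul_cancel₀ _ hs0.ne', Real.toNNReal_coe, Real.toNNReal_coe, Real.toNNReal_zero] at h
  have hβ := c.neg_dist_le_dist_sub x s
  set e := dist x (c.toFun s) - (s : ℝ) with he
  have hes : dist x (c.toFun s) = s + e := by rw [he]; ring
  change _ ^ 2 ≤ _ * d ^ 2 + _ - _ at h
  rw [hes] at h
  -- Stewart for `x` and the segment from `c 0` to `c s`, with an error term that no longer depends
  -- on `s`.
  have key : dist x (c.toFun t) ^ 2 ≤ (t + e) ^ 2 + d ^ 2 := by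
    refine h.trans ?_
    have : (1 - (t : ℝ) / s) * d ^ 2 + t / s * (s + e) ^ 2 - t / s * (1 - t / s) * s ^ 2 =
        (t + e) ^ 2 + (1 - t / s) * (d ^ 2 - e ^ 2) := by field_simp; ring
    rw [this]
    nlinarith [mul_nonneg hr.1 (sq_nonneg d), mul_nonneg (sub_nonneg.2 hr.2) (sq_nonneg e)]
  have hpos : 0 < (t : ℝ) - d := sub_pos.2 ht
  -- This is `√(r² + d²) ≤ r + d²/(2r)` in disguise, with `r = t + e ≥ t - d > 0`.
  have hq : d ^ 2 ≤ 2 * (t + e) * (d ^ 2 / (2 * (t - d))) := by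
    rw [mul_div_assoc', le_div_iff₀ (by positivity)]
    nlinarith [mul_nonneg (sq_nonneg d) (show 0 ≤ e + d by linarith)]
  have hE : 0 ≤ d ^ 2 / (2 * (t - d)) := by positivity
  have : dist x (c.toFun t) ≤ (t + e) + d ^ 2 / (2 * (t - d)) :=
    (abs_le_of_sq_le_sq' (by nlinarith) (by linarith)).2
  change _ ≤ e + d ^ 2 / (2 * (t - d))
  linarith

/-- The horofunctions of asymptotic rays differ by a constant. -/
theorem IsCAT0.horofunction_sub_eq (hX : IsCAT0 X) {c c' : GeodesicRay X}
    (h : c.endpoint = c'.endpoint) (x y : X) :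
    c.horofunction x - c.horofunction y = c'.horofunction x - c'.horofunction y := by
  have main : ∀ (c c' : GeodesicRay X), c.endpoint = c'.endpoint → ∀ x y,
      c.horofunction y + c'.horofunction x - (c.horofunction x + c'.horofunction y) ≤ 0 := by
    intro c c' h x y
    obtain ⟨K, hK⟩ : ∃ K : ℝ, ∀ t, dist (c.toFun t) (c'.toFun t) ≤ K := Quotient.exact h
    set u := fun t : ℝ≥0 => dist x (c.toFun t) - (t : ℝ)
    set v := fun t : ℝ≥0 => dist y (c.toFun t) - (t : ℝ)
    set u' := fun t : ℝ≥0 => dist x (c'.toFun t) - (t : ℝ)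
    set v' := fun t : ℝ≥0 => dist y (c'.toFun t) - (t : ℝ)
    have hu : Tendsto u atTop _ := c.tendsto_horofunction x
    have hv : Tendsto v atTop _ := c.tendsto_horofunction y
    have hu' : Tendsto u' atTop _ := c'.tendsto_horofunction x
    have hv' : Tendsto v' atTop _ := c'.tendsto_horofunction y
    -- The four-point inequality for `x, y, c t, c' t` loses its `t²` terms upon expansion. What
    -- remains is `2t` times the desired combination, bounded by a convergent quantity; division by
    -- `2t` makes the bound vanish in the limit.
    have hnum := ((((hu.pow 2).add (hv'.pow 2)).sub ((hv.pow 2).add (hu'.pow 2))).add_const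
      (dist x y ^ 2 + K ^ 2)).div_atTop
      ((NNReal.tendsto_coe_atTop.2 tendsto_id).const_mul_atTop (zero_lt_two' ℝ))
    refine le_of_tendsto_of_tendsto ((hv.add hu').sub (hu.add hv')) hnum ?_
    filter_upwards [eventually_gt_atTop 0] with t ht
    have ht' : (0 : ℝ) < t := ht
    rw [id, le_div_iff₀ (by positivity)]
    have h4 := hX.dist_sq_add_dist_sq_le x y (c.toFun t) (c'.toFun t)
    have hK2 := pow_le_pow_left₀ dist_nonneg (hK t) 2
    rw [show dist x (c.toFun t) = t + u t by simp [u],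
      show dist y (c.toFun t) = t + v t by simp [v],
      show dist x (c'.toFun t) = t + u' t by simp [u'],
      show dist y (c'.toFun t) = t + v' t by simp [v']] at h4
    linarith
  -- Exchanging the two rays reverses the inequality.
  linarith [main c c' h x y, main c' c h.symm x y]

end Horofunction

/-! ## Busemann functions -/

section Busemann

variable {X : Type*} [MetricSpace X]

/-- The subtracted constant is zero when the chosen ray starts at `x₀`; keeping it makes the formula
valid in every metric space, including for the default value of `rayFrom`. -/
theorem busemann_eq_horofunction (x₀ : X) (ξ : Boundary X) (x : X) :
    busemann x₀ ξ x = (rayFrom x₀ ξ).horofunction x - (rayFrom x₀ ξ).horofunction x₀ := by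
  refine Tendsto.limUnder_eq ?_
  refine (((rayFrom x₀ ξ).tendsto_horofunction x).sub
    ((rayFrom x₀ ξ).tendsto_horofunction x₀)).congr fun t => ?_
  ring

/-- The Busemann function can be computed from any ray in the class. -/
theorem IsCAT0.busemann_endpoint (hX : IsCAT0 X) (x₀ : X) (c : GeodesicRay X) (x : X) :
    busemann x₀ c.endpoint x = c.horofunction x - c.horofunction x₀ := by
  rw [busemann_eq_horofunction]
  exact hX.horofunction_sub_eq (endpoint_rayFrom _ _) _ _

theorem abs_busemann_sub_le (x₀ : X) (ξ : Boundary X) (x y : X) :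
    |busemann x₀ ξ x - busemann x₀ ξ y| ≤ dist x y := by
  rw [busemann_eq_horofunction, busemann_eq_horofunction, sub_sub_sub_cancel_right]
  exact GeodesicRay.abs_horofunction_sub_le _ _ _

theorem abs_busemann_le (x₀ : X) (ξ : Boundary X) (x : X) : |busemann x₀ ξ x| ≤ dist x x₀ := by
  rw [busemann_eq_horofunction]
  exact GeodesicRay.abs_horofunction_sub_le _ _ _

theorem IsCAT0.isGeodesicallyConvex_busemann (hX : IsCAT0 X) (x₀ : X) (ξ : Boundary X) :
    IsGeodesicallyConvex (busemann x₀ ξ) := by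
  intro a b g hg
  have := (hX.isGeodesicallyConvex_horofunction (rayFrom x₀ ξ) a b g hg).add_const
    (-(rayFrom x₀ ξ).horofunction x₀)
  refine this.congr fun t _ => ?_
  simp [busemann_eq_horofunction, sub_eq_add_neg]

/-- Busemann functions depend continuously on the point at infinity. -/
theorem IsCAT0.continuous_busemann [ProperSpace X] (hX : IsCAT0 X) (x₀ x : X) :
    Continuous fun ξ : Boundary X => busemann x₀ ξ x := by
  have hE : Tendsto (fun t : ℝ≥0 => dist x x₀ ^ 2 / (2 * ((t : ℝ) - dist x x₀))) atTop (𝓝 0) :=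
    tendsto_const_nhds.div_atTop ((tendsto_atTop_add_const_right _ _
      (NNReal.tendsto_coe_atTop.2 tendsto_id)).const_mul_atTop (zero_lt_two' ℝ))
  have hunif : TendstoUniformly
      (fun (t : ℝ≥0) (ξ : Boundary X) => dist x ((rayFrom x₀ ξ).toFun t) - (t : ℝ))
      (fun ξ => busemann x₀ ξ x) atTop := by
    rw [Metric.tendstoUniformly_iff]
    intro ε hε
    filter_upwards [hE.eventually_lt_const hε,
      (NNReal.tendsto_coe_atTop.2 tendsto_id).eventually_gt_atTop (dist x x₀)] with t h1 h2 ξ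
    have h0 := hX.rayFrom_zero x₀ ξ
    have hb : busemann x₀ ξ x = (rayFrom x₀ ξ).horofunction x := by
      have := (rayFrom x₀ ξ).horofunction_zero
      rw [h0] at this
      rw [busemann_eq_horofunction, this, sub_zero]
    have h3 := hX.dist_sub_le_horofunction_add (rayFrom x₀ ξ) x (t := t) (by rwa [h0])
    have h4 := (rayFrom x₀ ξ).horofunction_le x t
    rw [h0] at h3
    rw [hb, Real.dist_eq, abs_lt]
    constructor <;> linarith
  exact hunif.continuous (Eventually.of_forall fun t =>
    ((continuous_const.dist (continuous_rayFrom_apply x₀ t)).sub continuous_const)).frequently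

theorem IsCAT0.integrable_busemann [ProperSpace X] (hX : IsCAT0 X) (x₀ x : X)
    {B : Set (Boundary X)} (π : ProbabilityMeasure B) :
    Integrable (fun ξ : B => busemann x₀ (ξ : Boundary X) x) (π : Measure B) :=
  Integrable.of_bound
    ((hX.continuous_busemann x₀ x).comp continuous_subtype_val).measurable.aestronglyMeasurable
    (dist x x₀) (Eventually.of_forall fun ξ => abs_busemann_le x₀ ξ x)

/-- Transformation rule of Busemann functions under isometries. -/
theorem IsCAT0.busemann_map {Y : Type*} [MetricSpace Y] (hX : IsCAT0 X) (hY : IsCAT0 Y)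
    {γ : X → Y} (hγ : Isometry γ) (x₀ x : X) (y₀ : Y) (ξ : Boundary X) :
    busemann y₀ (Boundary.map γ hγ ξ) (γ x) - busemann y₀ (Boundary.map γ hγ ξ) (γ x₀) =
      busemann x₀ ξ x := by
  induction ξ using Quotient.inductionOn with
  | h c =>
  change busemann y₀ (c.map γ hγ).endpoint (γ x) - busemann y₀ (c.map γ hγ).endpoint (γ x₀) =
    busemann x₀ c.endpoint x
  rw [hY.busemann_endpoint, hY.busemann_endpoint, hX.busemann_endpoint, c.horofunction_map,
    c.horofunction_map]
  ring

end Busemann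

/-! ## Averaged Busemann functions -/

section Averaged

variable {Ω : Type*} {X : Ω → Type*} [∀ ω, MetricSpace (X ω)]

theorem continuous_averagedBusemann [∀ ω, ProperSpace (X ω)] (hX : ∀ ω, IsCAT0 (X ω)) (x₀ : ∀ ω, X ω)
    (B : ∀ ω, Set (Boundary (X ω))) (π : ∀ ω, ProbabilityMeasure (B ω)) (ω : Ω) :
    Continuous (averagedBusemann x₀ B π ω) := by
  refine (LipschitzWith.of_dist_le_mul (K := 1) fun x y => ?_).continuous
  rw [NNReal.coe_one, one_mul, Real.dist_eq, averagedBusemann, averagedBusemann,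
    ← integral_sub ((hX ω).integrable_busemann _ _ _) ((hX ω).integrable_busemann _ _ _)]
  have := norm_integral_le_of_norm_le_const (μ := (π ω : Measure (B ω)))
    (f := fun ξ : B ω => busemann (x₀ ω) (ξ : Boundary (X ω)) x -
      busemann (x₀ ω) (ξ : Boundary (X ω)) y)
    (Eventually.of_forall fun ξ : B ω => abs_busemann_sub_le (x₀ ω) (ξ : Boundary (X ω)) x y)
  simpa using this

theorem isGeodesicallyConvex_averagedBusemann [∀ ω, ProperSpace (X ω)] (hX : ∀ ω, IsCAT0 (X ω)) (x₀ : ∀ ω, X ω)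
    (B : ∀ ω, Set (Boundary (X ω))) (π : ∀ ω, ProbabilityMeasure (B ω)) (ω : Ω) :
    IsGeodesicallyConvex (averagedBusemann x₀ B π ω) := by
  intro a b g hg
  refine ⟨convex_Icc a b, fun s hs t ht p q hp hq hpq => ?_⟩
  simp only [smul_eq_mul, averagedBusemann]
  have hi := fun x => (hX ω).integrable_busemann (x₀ ω) x (π ω)
  rw [← integral_const_mul, ← integral_const_mul,
    ← integral_add ((hi _).const_mul p) ((hi _).const_mul q)]
  exact integral_mono (hi _) (((hi _).const_mul p).add ((hi _).const_mul q)) fun ξ =>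
    ((hX ω).isGeodesicallyConvex_busemann (x₀ ω) ξ a b g hg).2 hs ht hp hq hpq

/-- The evaluation of Busemann functions at a Borel section is a Borel section of `𝓒(B)`. -/
theorem isBorelFunctionOnSubfield_busemann [MeasurableSpace Ω] [∀ ω, ProperSpace (X ω)]
    (hX : ∀ ω, IsCAT0 (X ω)) (S : BorelStructure X) (x₀ : ∀ ω, X ω)
    (B : ∀ ω, Set (Boundary (X ω))) (x : ∀ ω, X ω) (hx : x ∈ S.sections) :
    IsBorelFunctionOnSubfield S x₀ B fun ω =>
      ⟨fun ξ => busemann (x₀ ω) (ξ : Boundary (X ω)) (x ω),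
        ((hX ω).continuous_busemann (x₀ ω) (x ω)).comp continuous_subtype_val⟩ := by
  intro ξ hξ
  have h : Measurable fun ω : Ω => (⟨ω, mem_univ ω⟩ : (univ : Set Ω)) :=
    measurable_id.subtype_mk
  have := Measurable.comp (hξ x hx) h
  exact this

theorem measurable_averagedBusemann [MeasurableSpace Ω] [∀ ω, ProperSpace (X ω)]
    (hX : ∀ ω, IsCAT0 (X ω)) (S : BorelStructure X) (x₀ : ∀ ω, X ω)
    (B : ∀ ω, Set (Boundary (X ω))) (π : ∀ ω, ProbabilityMeasure (B ω))
    (hπ : IsBorelProbSection S x₀ B π) (x : ∀ ω, X ω) (hx : x ∈ S.sections) :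
    Measurable fun ω => averagedBusemann x₀ B π ω (x ω) :=
  hπ _ (isBorelFunctionOnSubfield_busemann hX S x₀ B x hx)

theorem FieldAction.apply_apply [MeasurableSpace Ω] {S : BorelStructure X} {R : Set (Ω × Ω)}
    (hR : IsBorelEquivRel R) (α : FieldAction S R) {ω ω' : Ω} (h : (ω, ω') ∈ R)
    (h' : (ω', ω) ∈ R) (y : X ω') : α.toFun ω ω' h (α.toFun ω' ω h' y) = y := by
  have hr := hR.refl ω'
  rw [α.cocycle ω' ω ω' h' h hr]
  -- `α(ω', ω')` is idempotent and injective, hence the identity.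
  exact (α.bijective ω' ω' hr).1 (α.cocycle _ _ _ hr hr hr y)

theorem FieldAction.isQuasiInvariantWith_averagedBusemann [MeasurableSpace Ω]
    [∀ ω, ProperSpace (X ω)] (hX : ∀ ω, IsCAT0 (X ω)) {S : BorelStructure X} (x₀ : ∀ ω, X ω)
    (B : ∀ ω, Set (Boundary (X ω))) (π : ∀ ω, ProbabilityMeasure (B ω)) {R : Set (Ω × Ω)}
    (hR : IsBorelEquivRel R) (α : FieldAction S R) (hα : α.IsIsometric)
    (hinv : α.IsInvariantProb hα B π) :
    α.IsQuasiInvariantWith (averagedBusemann x₀ B π)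
      (fun ω ω' h => - averagedBusemann x₀ B π ω' (α.toFun ω ω' h (x₀ ω))) := by
  intro ω ω' h h' y
  -- `F η` is the value at `y` of the Busemann function of `η` renormalized to vanish at the image
  -- of `x₀ ω`; its second term integrates to the cocycle.
  set F : Boundary (X ω') → ℝ := fun η =>
    busemann (x₀ ω') η y - busemann (x₀ ω') η (α.toFun ω ω' h (x₀ ω))
  have hF : Continuous F :=
    ((hX ω').continuous_busemann _ _).sub ((hX ω').continuous_busemann _ _)
  have hα' : Measurable fun ξ : B ω => α.boundaryMap hα ω ω' h ξ :=
    (((hX ω).continuous_boundaryMap (hX ω') (hα ω ω' h) (α.bijective ω ω' h).2).comp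
      continuous_subtype_val).measurable
  calc averagedBusemann x₀ B π ω (α.toFun ω' ω h' y)
      = ∫ ξ : B ω, F (α.boundaryMap hα ω ω' h ξ) ∂(π ω : Measure (B ω)) := by
        refine integral_congr_ae (Eventually.of_forall fun ξ => ?_)
        have := (hX ω).busemann_map (hX ω') (hα ω ω' h) (x₀ ω) (α.toFun ω' ω h' y) (x₀ ω') ξ
        rw [α.apply_apply hR] at this
        exact this.symm
    _ = ∫ η, F η ∂(Measure.map (fun ξ : B ω => α.boundaryMap hα ω ω' h ξ)
          (π ω : Measure (B ω))) :=
        (integral_map hα'.aemeasurable hF.measurable.aestronglyMeasurable).symm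
    _ = ∫ η : B ω', F η ∂(π ω' : Measure (B ω')) := by
        rw [hinv ω ω' h]
        exact integral_map measurable_subtype_coe.aemeasurable
          hF.measurable.aestronglyMeasurable
    _ = _ := by
        rw [integral_sub ((hX ω').integrable_busemann _ _ _)
          ((hX ω').integrable_busemann _ _ _), sub_eq_add_neg]
        rfl

/-- Transporting a point from `ω''` to `ω` directly or through `ω'` gives the same value of `f`. The
section `x` only supplies such a point. -/
theorem FieldAction.IsQuasiInvariantWith.isAdditiveCocycle [MeasurableSpace Ω]
    {S : BorelStructure X} {R : Set (Ω × Ω)} (hR : IsBorelEquivRel R) {α : FieldAction S R}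
    {f : ∀ ω, X ω → ℝ} {c : ∀ ω ω', (ω, ω') ∈ R → ℝ} (hf : α.IsQuasiInvariantWith f c)
    (x : ∀ ω, X ω) : IsAdditiveCocycle R c := by
  intro ω ω' ω'' h h' h''
  have e := hf ω ω'' h'' (hR.symm _ _ h'') (x ω'')
  rw [← α.cocycle ω'' ω' ω (hR.symm _ _ h') (hR.symm _ _ h),
    hf ω ω' h, hf ω' ω'' h'] at e
  linarith

end Averaged

theorem mainTheorem11 {Ω : Type*} [MeasurableSpace Ω] (X : Ω → Type*)
    [∀ ω, MetricSpace (X ω)] [∀ ω, ProperSpace (X ω)] (hX : ∀ ω, IsCAT0 (X ω))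
    (S : BorelStructure X) (x₀ : ∀ ω, X ω) (hx₀ : x₀ ∈ S.sections)
    (B : ∀ ω, Set (Boundary (X ω))) (hBclosed : ∀ ω, IsClosed (B ω))
    (hB : IsBorelBoundarySubfield S x₀ B)
    (π : ∀ ω, ProbabilityMeasure (B ω)) (hπ : IsBorelProbSection S x₀ B π) :
    -- the averaged Busemann functions are well defined
    ((∀ ω (x : X ω), Integrable (fun ξ : B ω => busemann (x₀ ω) (ξ : Boundary (X ω)) x)
        (π ω : Measure (B ω))) ∧
      -- they form a Borel section of continuous functions, and each of them is convex
      IsBorelContinuousSection S (averagedBusemann x₀ B π) ∧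
      ∀ ω, IsGeodesicallyConvex (averagedBusemann x₀ B π ω)) ∧
    -- quasi-invariance
    ∀ (R : Set (Ω × Ω)), IsBorelEquivRel R → ∀ (α : FieldAction S R) (hα : α.IsIsometric),
      α.IsInvariantSubfield hα B → α.IsInvariantProb hα B π →
      α.IsQuasiInvariantWith (averagedBusemann x₀ B π)
          (fun ω ω' h => - averagedBusemann x₀ B π ω' (α.toFun ω ω' h (x₀ ω))) ∧
        IsAdditiveCocycle R
          (fun ω ω' h => - averagedBusemann x₀ B π ω' (α.toFun ω ω' h (x₀ ω))) := by
  refine ⟨⟨fun ω x => (hX ω).integrable_busemann _ _ _,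
    ⟨continuous_averagedBusemann hX x₀ B π, measurable_averagedBusemann hX S x₀ B π hπ⟩,
    isGeodesicallyConvex_averagedBusemann hX x₀ B π⟩, fun R hR α hα _ hinv => ?_⟩
  have hq := α.isQuasiInvariantWith_averagedBusemann hX x₀ B π hR hα hinv
  exact ⟨hq, hq.isAdditiveCocycle hR x₀⟩
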